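/- For every integer $d\ge 1$ there is a constant $C>0$, depending only on $d$, such that the following holds for every finite field $\mathbb F_q$ with $q$ elements, $q$ odd, every non-trivial additive character $\chi:\mathbb F_q\to\mathbb C^*$, every non-degenerate quadratic form $Q(x)=\sum_{i,k=1}^d a_{ik}x_ix_k$ over $\mathbb F_q$ (that is, $a_{ik}=a_{ki}$ and the matrix $(a_{ik})$ is invertible), and every $j\in\mathbb F_q\setminus\{0\}$. Let $S_j=\{x\in\mathbb F_q^d: Q(x)=j\}$, and let $$\widehat{S_j}(m)=q^{-d}\sum_{x\in\mathbb F_q^d}\chi(-x\cdot m)\,1_{S_j}(x)$$ be the Fourier transform of its indicator function $1_{S_j}$. Then: (a) for every $m\in\mathbb F_q^d$ with $m\neq(0,\dots,0)$, $$|\widehat{S_j}(m)|=\Big|q^{-d}\sum_{x\in S_j}\chi(-x\cdot m)\Big|\le C\,q^{-\frac{d+1}{2}};$$ (b) if $d\ge 2$, then $\widehat{S_j}(0,\dots,0)$ is a real number and $$\widehat{S_j}(0,\dots,0)\le C\,q^{-1}\quad\text{and}\quad q^{-1}\le C\,\widehat{S_j}(0,\dots,0),$$ and consequently $$\#S_j\le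 C\,q^{d-1}\quad\text{and}\quad q^{d-1}\le C\,\#S_j .$$ -/

import Mathlib

/-- The quadratic form `Q(x) = ∑ i k, a_{ik} x_i x_k` (a polynomial in `d` variables over `F`) is
non-degenerate: it is given by a symmetric, invertible matrix `a`. When `2` is invertible in `F`,
the homogeneous polynomials of degree two are exactly the polynomials given by some symmetric
matrix, and this matrix is then unique. -/
def IsNondegenerateQuadratic {F : Type*} [Field F] {d : ℕ} (Q : MvPolynomial (Fin d) F) : Prop :=
  ∃ a : Matrix (Fin d) (Fin d) F, a.IsSymm ∧ IsUnit a ∧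
    Q = ∑ i, ∑ k, MvPolynomial.C (a i k) * MvPolynomial.X i * MvPolynomial.X k

/-- The quadratic surface `S_j = {x ∈ F^d : Q(x) = j}`. -/
noncomputable def quadraticSurface {F : Type*} [Field F] [Fintype F] [DecidableEq F] {d : ℕ}
    (Q : MvPolynomial (Fin d) F) (j : F) : Finset (Fin d → F) :=
  Finset.univ.filter fun x => MvPolynomial.eval x Q = j

/-- The Fourier transform `f̂(m) = q^{-d} ∑_{x ∈ F^d} χ(-x·m) f(x)`, where `q = #F`. -/
noncomputable def fourierFq {F : Type*} [Field F] [Fintype F] {d : ℕ}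
    (χ : AddChar F ℂ) (f : (Fin d → F) → ℂ) (m : Fin d → F) : ℂ :=
  ((Fintype.card F : ℂ) ^ d)⁻¹ * ∑ x : Fin d → F, χ (-(x ⬝ᵥ m)) * f x

/-- The characteristic function of a finite subset of `F^d`. -/
noncomputable def surfaceIndicator {F : Type*} {d : ℕ} (E : Finset (Fin d → F)) : (Fin d → F) → ℂ :=
  Set.indicator (E : Set (Fin d → F)) 1

/-!
Expanding the indicator function of `S_j` in additive characters and completing the square
(`card_mul_sum_addChar_surface`) gives, for some `e` depending on `m`,
`q ∑_{x ∈ S_j} χ(-x·m) = q^d [m = 0] + ∑_{t ≠ 0} g(t) χ(-j t + e / t)`,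
where `g(t) = ∑ χ(t Q(x))` is a Gauss sum of absolute value `q^{d/2}` (`norm_quadraticGaussSum`).
As `g(t)` only depends on the square class of `t`, it is a combination of `1` and the quadratic
character `η`. What remains are a Kloosterman sum `∑ χ(-j t + e / t)` and a Salié sum
`∑ η(t) χ(-j t + e / t)`, and the theorem follows from the bound `2 √q` for both. The Salié sum is
evaluated explicitly (`norm_sum_quadraticChar_mul_addChar_le`). For `m = 0` both sums are elementary
and the main term `q^d` dominates.

The bound for Kloosterman sums (`norm_kloostermanSum_le`) is Weil's; the proof here is elementary.
A direct count (`kloostermanSum_quadraticAlgebra`) shows that the Kloosterman sums over `K` and over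
its quadratic extension `L` satisfy `Kl_L = 2 #K - Kl_K²`. If `|Kl_F|` exceeded `2 √q`, the ratio
`|Kl_L| / √#L` would be unbounded along a tower of quadratic extensions `L` of `F`. But this ratio
is bounded, by a constant depending on `q`: Stepanov's method (`card_trace_add_inv_eq_le`) bounds
the number of `x ∈ L` with `Tr(x + b / x) = c` by `#L / q + 3 √#L` for each `c ∈ F`. As the degree of
`L` over `F` is even, the auxiliary polynomial can be built from half of the trace, and it is enough
to let it vanish to the first order.
-/

/-! ### Stepanov's bound for the fibres of the trace -/

open Polynomial in
theorem Polynomial.sum_C_mul_ne_zero_of_monic {R ι : Type*} [CommRing R] [Nontrivial R] [Fintype ι]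
    {P : ι → R[X]} (hP : ∀ i, (P i).Monic) (hinj : Function.Injective fun i => (P i).natDegree)
    {w : ι → R} (hw : w ≠ 0) : ∑ i, C (w i) * P i ≠ 0 := by
  classical
  obtain ⟨i₀, hi₀⟩ := Function.ne_iff.1 hw
  have hdeg : ∀ i, w i ≠ 0 → (C (w i) * P i).degree = ((P i).natDegree : WithBot ℕ) := by
    intro i hi
    rw [(hP i).degree_mul, degree_C hi, zero_add, degree_eq_natDegree (hP i).ne_zero]
  have hne : ∀ i, C (w i) * P i ≠ 0 → w i ≠ 0 := by
    rintro i h h0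
    simp [h0] at h
  intro h0
  have hsum := degree_sum_eq_of_disjoint (fun i => C (w i) * P i) Finset.univ (by
    rintro i ⟨-, hi⟩ j ⟨-, hj⟩ hij h
    simp only [Function.comp, hdeg i (hne i hi), hdeg j (hne j hj)] at h
    exact hij (hinj (by exact_mod_cast h)))
  rw [h0, degree_zero] at hsum
  have := Finset.le_sup (f := fun i => (C (w i) * P i).degree) (Finset.mem_univ i₀)
  rw [← hsum, hdeg i₀ hi₀] at this
  simp at this

/-- More polynomials than the dimension of the space they live in satisfy a linear relation. -/
theorem Polynomial.exists_sum_C_mul_eq_zero_of_natDegree_lt {K ι : Type*} [Field K] [Fintype ι]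
    {M : ℕ} (hM : M < Fintype.card ι) {P : ι → Polynomial K} (hP : ∀ i, (P i).natDegree < M) :
    ∃ u : ι → K, u ≠ 0 ∧ ∑ i, C (u i) * P i = 0 := by
  let v : ι → degreeLT K M := fun i => ⟨P i, mem_degreeLT.2
    (lt_of_le_of_lt degree_le_natDegree (by exact_mod_cast hP i))⟩
  have hv : ¬ LinearIndependent K v := fun h => by
    have := h.fintype_card_le_finrank
    rw [(degreeLTEquiv K M).finrank_eq, Module.finrank_fin_fun] at this
    omega
  obtain ⟨u, hu, i, hi⟩ := Fintype.not_linearIndependent_iff.1 hv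
  refine ⟨u, fun h => hi (by simp [h]), ?_⟩
  have := congrArg Subtype.val hu
  simpa [v, smul_eq_C_mul] using this

theorem FiniteField.exists_algHom_eq_pow_card_pow (F K : Type*) [Field F] [Fintype F] [Field K]
    [Algebra F K] (n : ℕ) : ∃ σ : K →ₐ[F] K, ∀ x, σ x = x ^ Fintype.card F ^ n := by
  refine ⟨FiniteField.frobeniusAlgHom F K ^ n, fun x => ?_⟩
  induction n with
  | zero => simp
  | succ n ih => rw [pow_succ', AlgHom.mul_apply, ih]; simp [pow_succ, pow_mul]

section
variable {F K : Type*} [Field F] [Fintype F] [Field K] [Algebra F K]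

open Polynomial in
/-- The polynomial `X ^ q ^ (N - 1) * ∑ (X + b / X) ^ q ^ i`, the sum being over `i < N`: half of the
trace of `X + b / X` from a field of degree `2 N` over `F`, with the denominator cleared. The
exponents `q ^ (N - 1) - q ^ i` are genuine differences of natural numbers for `i < N`. -/
noncomputable def halfTracePoly (K : Type*) [Field K] [Algebra F K] (b : F) (N : ℕ) : K[X] :=
  ∑ i ∈ Finset.range N, (X ^ (Fintype.card F ^ (N - 1) + Fintype.card F ^ i)
    + C (algebraMap F K b) * X ^ (Fintype.card F ^ (N - 1) - Fintype.card F ^ i))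

open Polynomial in
theorem halfTracePoly_monic_natDegree (b : F) {N : ℕ} (hN : 1 ≤ N) :
    (halfTracePoly K b N).Monic ∧
      (halfTracePoly K b N).natDegree = 2 * Fintype.card F ^ (N - 1) := by
  obtain ⟨n, rfl⟩ : ∃ n, N = n + 1 := ⟨N - 1, by omega⟩
  set q := Fintype.card F with hq
  have hq1 : 1 < q := Fintype.one_lt_card
  set s := q ^ n with hs
  have hs0 : 0 < s := by positivity
  have hmem : C (algebraMap F K b) + ∑ i ∈ Finset.range n, (X ^ (s + q ^ i)
    + C (algebraMap F K b) * X ^ (s - q ^ i)) ∈ degreeLT K (2 * s) := by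
    refine add_mem ?_ (sum_mem fun i hi => add_mem ?_ ?_)
    · exact mem_degreeLT.2 (lt_of_le_of_lt degree_C_le (by exact_mod_cast (by omega)))
    · have : q ^ i < s := Nat.pow_lt_pow_right hq1 (Finset.mem_range.1 hi)
      exact mem_degreeLT.2 (by rw [degree_X_pow]; exact_mod_cast (by omega))
    · exact mem_degreeLT.2 (lt_of_le_of_lt (degree_C_mul_X_pow_le _ _)
        (by exact_mod_cast (by omega)))
  have hU : halfTracePoly K b (n + 1) = X ^ (2 * s) + (C (algebraMap F K b) +
      ∑ i ∈ Finset.range n, (X ^ (s + q ^ i) + C (algebraMap F K b) * X ^ (s - q ^ i))) := by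
    simp only [halfTracePoly, Nat.add_sub_cancel, ← hq, ← hs]
    rw [Finset.sum_range_succ, ← hs, ← two_mul, Nat.sub_self, pow_zero, mul_one]
    ring
  have hlt := mem_degreeLT.1 hmem
  rw [Nat.add_sub_cancel, ← hs, hU]
  refine ⟨monic_X_pow_add (by exact_mod_cast hlt), ?_⟩
  rw [natDegree_add_eq_left_of_degree_lt, natDegree_X_pow]
  rw [degree_X_pow]
  exact_mod_cast hlt

open Polynomial in
theorem eval_halfTracePoly (b : F) (N : ℕ) {x : K} (hx : x ≠ 0) :
    (halfTracePoly K b N).eval x = x ^ Fintype.card F ^ (N - 1) *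
      ∑ i ∈ Finset.range N, (x + algebraMap F K b * x⁻¹) ^ Fintype.card F ^ i := by
  rw [halfTracePoly, eval_finsetSum, Finset.mul_sum]
  refine Finset.sum_congr rfl fun i hi => ?_
  obtain ⟨σ, hσ⟩ := FiniteField.exists_algHom_eq_pow_card_pow F K i
  rw [← hσ, map_add, map_mul, AlgHom.commutes, hσ, hσ]
  have hle : Fintype.card F ^ i ≤ Fintype.card F ^ (N - 1) :=
    Nat.pow_le_pow_right Fintype.card_pos (by have := Finset.mem_range.1 hi; omega)
  simp only [eval_add, eval_mul, eval_pow, eval_X, eval_C]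
  rw [pow_sub₀ x hx hle, pow_add, inv_pow]
  ring

/-- The trace of `y = x + b / x` is `T + T ^ (q ^ N)`, where `T` is the sum of the first `N` of the
`2 N` conjugates of `y`. On a fibre of the trace, raising `T` to the power `q ^ N = √#K` is
therefore an affine map, which is what replaces the derivatives in Stepanov's method. -/
theorem halfTrace_pow_eq (b c : F) {N : ℕ} (hK : Module.finrank F K = 2 * N) [Finite K] {x : K}
    (hx : Algebra.trace F K (x + algebraMap F K b * x⁻¹) = c) :
    (∑ i ∈ Finset.range N, (x + algebraMap F K b * x⁻¹) ^ Fintype.card F ^ i)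
        ^ Fintype.card F ^ N =
      algebraMap F K c -
        ∑ i ∈ Finset.range N, (x + algebraMap F K b * x⁻¹) ^ Fintype.card F ^ i := by
  obtain ⟨σ, hσ⟩ := FiniteField.exists_algHom_eq_pow_card_pow F K N
  rw [eq_sub_iff_add_eq, ← hσ, map_sum, ← hx, FiniteField.algebraMap_trace_eq_sum_pow, hK, two_mul,
    Finset.sum_range_add, add_comm, Nat.card_eq_fintype_card]
  congr 1
  refine Finset.sum_congr rfl fun i _ => ?_
  rw [hσ, ← pow_mul, pow_add, mul_comm (_ ^ i)]

open Polynomial in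
/-- The relation behind the auxiliary polynomial. There are `(s + 2) q s` coefficients `u` to choose,
and the degree bound leaves fewer linear conditions on them. -/
theorem exists_sum_C_mul_X_pow_mul_sub_pow_eq_zero {K : Type*} [Field K] {q s : ℕ} (hq : 1 < q)
    (hs : 0 < s) (c : K) {U : K[X]} (hU : U.natDegree ≤ 2 * s) :
    ∃ u : Fin (s + 2) × Fin q × Fin s → K, u ≠ 0 ∧
      ∑ t, C (u t) * (X ^ (q * s * t.2.2 + t.1 + s * (q - 1 - t.2.1)) *
        (C c * X ^ s - U) ^ (t.2.1 : ℕ)) = 0 := by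
  have hV : (C c * X ^ s - U).natDegree ≤ 2 * s :=
    (natDegree_sub_le_of_le ((natDegree_C_mul_X_pow_le _ _).trans (by omega)) hU).trans
      (max_self (2 * s)).le
  apply exists_sum_C_mul_eq_zero_of_natDegree_lt
    (M := q * s * (s - 1) + (s + 1) + 2 * s * (q - 1) + 1)
  · simp only [Fintype.card_prod, Fintype.card_fin]
    clear hV hU U c
    obtain ⟨s, rfl⟩ : ∃ s', s = s' + 1 := ⟨s - 1, by omega⟩
    obtain ⟨q, rfl⟩ : ∃ q', q = q' + 1 := ⟨q - 1, by omega⟩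
    have h : (s + 1 + 2) * ((q + 1) * (s + 1)) = (q + 1) * (s + 1) * s + (s + 1 + 1) +
        2 * (s + 1) * q + 1 + (s * q + 2 * s + q) := by ring
    simp only [Nat.add_sub_cancel]
    omega
  · rintro ⟨i, j, l⟩
    refine Nat.lt_succ_of_le ((natDegree_mul_le_of_le (natDegree_X_pow_le _)
      (natDegree_pow_le_of_le _ hV)).trans ?_)
    have h1 : q * s * (l : ℕ) ≤ q * s * (s - 1) := Nat.mul_le_mul_left _ (by omega)
    have h2 : s * (q - 1 - j) + j * (2 * s) ≤ 2 * s * (q - 1) := by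
      obtain ⟨e, he⟩ : ∃ e, q - 1 = j + e := ⟨q - 1 - j, by omega⟩
      have : 2 * s * (j + e) = s * e + j * (2 * s) + s * e := by ring
      rw [he, Nat.add_sub_cancel_left]
      omega
    have h3 : (i : ℕ) ≤ s + 1 := by omega
    dsimp only
    omega

open Polynomial in
/-- The auxiliary polynomial is non-zero because the degrees `l + s j + q s i + s (q - 1)` of its
terms are distinct: `(l, j, i)` are the digits of a mixed-radix expansion. -/
theorem sum_C_mul_X_pow_mul_pow_ne_zero {K : Type*} [Field K] {q s : ℕ}
    (hs : 0 < s) {U : K[X]} (hUm : U.Monic) (hUd : U.natDegree = 2 * s)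
    {w : Fin (s + 2) × Fin q × Fin s → K} (hw : w ≠ 0) :
    let G : K[X] := ∑ t, C (w t) *
      (X ^ (t.2.2 + q * s * t.1 + s * (q - 1 - t.2.1)) * U ^ (t.2.1 : ℕ))
    G ≠ 0 ∧ G.natDegree ≤ q * s * s + 3 * (q * s) := by
  have hRm : ∀ t : Fin (s + 2) × Fin q × Fin s,
      (X ^ (t.2.2 + q * s * t.1 + s * (q - 1 - t.2.1)) * U ^ (t.2.1 : ℕ)).Monic :=
    fun t => (monic_X_pow _).mul (hUm.pow _)
  have hRd : ∀ t : Fin (s + 2) × Fin q × Fin s,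
      (X ^ (t.2.2 + q * s * t.1 + s * (q - 1 - t.2.1)) * U ^ (t.2.1 : ℕ)).natDegree =
      (t.2.2 + s * t.2.1) + q * s * t.1 + s * (q - 1) := by
    rintro ⟨i, j, l⟩
    rw [(monic_X_pow _).natDegree_mul (hUm.pow _), natDegree_X_pow, hUm.natDegree_pow, hUd]
    obtain ⟨e, he⟩ : ∃ e, q - 1 = j + e := ⟨q - 1 - j, by omega⟩
    rw [he, Nat.add_sub_cancel_left]
    ring
  have hlt : ∀ (j : Fin q) (l : Fin s), (l : ℕ) + s * j < q * s := by
    intro j l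
    have : s * ((j : ℕ) + 1) ≤ s * q := Nat.mul_le_mul_left _ (by omega)
    rw [mul_comm q s]
    linarith [l.2]
  refine ⟨sum_C_mul_ne_zero_of_monic hRm ?_ hw, ?_⟩
  · rintro ⟨i, j, l⟩ ⟨i', j', l'⟩ h
    have h1 : (l : ℕ) + s * j + q * s * i = l' + s * j' + q * s * i' :=
      Nat.add_right_cancel ((hRd (i, j, l)).symm.trans (h.trans (hRd (i', j', l'))))
    have hr0 : 0 < q * s := Nat.mul_pos (by have := j.2; omega) hs
    have hi : (i : ℕ) = i' := by
      have := congrArg (· / (q * s)) h1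
      simpa only [Nat.add_mul_div_left _ _ hr0, Nat.div_eq_of_lt (hlt _ _), zero_add] using this
    have h2 : (l : ℕ) + s * j = l' + s * j' := by
      rw [hi] at h1; omega
    have hj : (j : ℕ) = j' := by
      have := congrArg (· / s) h2
      simpa only [Nat.add_mul_div_left _ _ hs, Nat.div_eq_of_lt l.2, Nat.div_eq_of_lt l'.2,
        zero_add] using this
    have hl : (l : ℕ) = l' := by
      rw [hj] at h2; omega
    simp only [Prod.mk.injEq, Fin.ext_iff]
    exact ⟨hi, hj, hl⟩
  · refine natDegree_sum_le_of_forall_le _ _ fun t _ => (natDegree_C_mul_le _ _).trans ?_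
    rw [hRd]
    have h1 := hlt t.2.1 t.2.2
    have h2 : q * s * (t.1 : ℕ) ≤ q * s * (s + 1) := Nat.mul_le_mul_left _ (by omega)
    have h3 : s * (q - 1) ≤ q * s := by
      rw [mul_comm q s]; exact Nat.mul_le_mul_left _ (by omega)
    rw [mul_add, mul_one] at h2
    omega

open Polynomial in
/-- Stepanov's bound for the fibres of `x ↦ Tr(x + b / x)`: with `#K = q ^ (2 N)`, each has at most
`#K / q + 3 √#K` elements. Every point of the fibre is a root of the auxiliary polynomial, because
the `√#K`-th power of its value there is, up to powers of `x`, the value of a polynomial that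
vanishes identically. -/
theorem card_trace_add_inv_eq_le [Fintype K] [DecidableEq K] [DecidableEq F] (b c : F) {N : ℕ}
    (hN : 1 ≤ N) (hK : Module.finrank F K = 2 * N) :
    (Finset.univ.filter fun x : K =>
        x ≠ 0 ∧ Algebra.trace F K (x + algebraMap F K b * x⁻¹) = c).card ≤
      Fintype.card F ^ (2 * N - 1) + 3 * Fintype.card F ^ N := by
  set q := Fintype.card F with hq
  have hq1 : 1 < q := Fintype.one_lt_card
  set s := q ^ (N - 1) with hs
  have hs0 : 0 < s := by positivity
  have hrs : q ^ N = q * s := by rw [hs, ← pow_succ', Nat.sub_add_cancel hN]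
  have hQ : q ^ (2 * N - 1) = q * s * s := by
    rw [← hrs, hs, ← pow_add]; congr 1; omega
  have hcardK : Fintype.card K = q * s * (q * s) := by
    rw [Module.card_eq_pow_finrank (K := F) (V := K), hK, ← hrs, ← pow_add, two_mul]
  obtain ⟨hUm, hUd⟩ := halfTracePoly_monic_natDegree (K := K) b hN
  rw [← hq, ← hs] at hUd
  obtain ⟨u, hu0, hu⟩ :=
    exists_sum_C_mul_X_pow_mul_sub_pow_eq_zero hq1 hs0 (algebraMap F K c) hUd.le
  -- As `#K = (q s)²`, the coefficients `u t ^ (q s)` are the `q s`-th roots of the `u t`.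
  have hw0 : (fun t => u t ^ (q * s)) ≠ 0 := by
    obtain ⟨t, ht⟩ := Function.ne_iff.1 hu0
    exact Function.ne_iff.2 ⟨t, pow_ne_zero _ ht⟩
  obtain ⟨hG0, hGd⟩ := sum_C_mul_X_pow_mul_pow_ne_zero hs0 hUm hUd hw0
  obtain ⟨σ, hσ⟩ := FiniteField.exists_algHom_eq_pow_card_pow F K N
  rw [hQ, hrs]
  rw [← hq, hrs] at hσ
  by_contra! hcon
  refine hG0 (eq_zero_of_natDegree_lt_card_of_eval_eq_zero' _ _ ?_ (hGd.trans_lt hcon))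
  intro x hx
  obtain ⟨-, hx0, hxc⟩ := Finset.mem_filter.1 hx
  have hTr := halfTrace_pow_eq b c hK hxc
  have hUx := eval_halfTracePoly b N hx0
  rw [← hq, ← hs] at hUx
  rw [← hq, hrs] at hTr
  generalize (∑ i ∈ Finset.range N, (x + algebraMap F K b * x⁻¹) ^ q ^ i) = T at hUx hTr
  generalize halfTracePoly K b N = U at *
  generalize hr : q * s = r at *
  have hfix : ∀ x : K, (x ^ r) ^ r = x := fun x => by
    rw [← pow_mul, ← hcardK, FiniteField.pow_card]
  have hsplit : ∀ j : Fin q, ∀ y : K, x ^ (s * (q - 1 - (j : ℕ))) * (x ^ s * y) ^ (j : ℕ) =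
      x ^ (s * (q - 1)) * y ^ (j : ℕ) := by
    intro j y
    obtain ⟨e, he⟩ : ∃ e, q - 1 = j + e := ⟨q - 1 - j, by omega⟩
    rw [he, Nat.add_sub_cancel_left]
    ring
  have hPx : ∀ t : Fin (s + 2) × Fin q × Fin s,
      (X ^ (r * t.2.2 + t.1 + s * (q - 1 - t.2.1)) *
        (C (algebraMap F K c) * X ^ s - U) ^ (t.2.1 : ℕ)).eval x =
      x ^ (r * t.2.2 + t.1 : ℕ) * (x ^ (s * (q - 1)) * (T ^ r) ^ (t.2.1 : ℕ)) := by
    intro t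
    rw [← hsplit, hTr]
    simp only [eval_mul, eval_pow, eval_X, eval_sub, eval_C, hUx]
    rw [pow_add _ _ (s * _), mul_sub, mul_comm (algebraMap F K c), mul_assoc]
  have hRx : ∀ t : Fin (s + 2) × Fin q × Fin s,
      (X ^ (t.2.2 + r * t.1 + s * (q - 1 - t.2.1)) * U ^ (t.2.1 : ℕ)).eval x =
      x ^ (t.2.2 + r * t.1 : ℕ) * (x ^ (s * (q - 1)) * T ^ (t.2.1 : ℕ)) := by
    intro t
    rw [← hsplit]
    simp only [eval_mul, eval_pow, eval_X, hUx]
    rw [pow_add _ _ (s * _), mul_assoc]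
  have h0 := congrArg (eval x) hu
  rw [eval_zero, eval_finsetSum] at h0
  rw [eval_finsetSum]
  simp only [eval_mul (p := C _), eval_C, hPx] at h0
  simp only [eval_mul (p := C _), eval_C, hRx]
  -- Raising to the power `r` sends `x ^ (r i)` to `x ^ i` and `T` to `c - T`, so it turns the
  -- auxiliary polynomial into the relation `h0`.
  have key : (∑ t : Fin (s + 2) × Fin q × Fin s, u t ^ r *
      (x ^ (t.2.2 + r * t.1 : ℕ) * (x ^ (s * (q - 1)) * T ^ (t.2.1 : ℕ)))) ^ r *
        x ^ (s * (q - 1)) = 0 := by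
    rw [← zero_mul ((x ^ (s * (q - 1))) ^ r), ← h0, ← hσ, map_sum, Finset.sum_mul, Finset.sum_mul]
    refine Finset.sum_congr rfl fun t _ => ?_
    rw [hσ, mul_pow, hfix, mul_pow, pow_add, mul_pow, pow_mul x r, pow_right_comm (x ^ r), hfix,
      mul_pow, pow_add, pow_mul x r, pow_right_comm x, pow_right_comm T]
    ring
  rcases mul_eq_zero.1 key with h | h
  · exact (pow_eq_zero_iff (by rw [← hr]; positivity)).1 h
  · exact absurd h (pow_ne_zero _ hx0)
end

/-! ### Kloosterman sums and quadratic extensions -/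

section
variable {K : Type*} [Field K] [Fintype K] [DecidableEq K]

/-- The Kloosterman sum `∑ ψ(x + a / x)` over the non-zero elements `x` of a finite field. -/
noncomputable def kloostermanSum (ψ : AddChar K ℂ) (a : K) : ℂ :=
  ∑ x with x ≠ 0, ψ (x + a * x⁻¹)

/-- An upper bound on all fibres of the trace is also a lower bound, since their sizes add up to
`#K - 1`. The constant `4 q` depends on `F` but not on the degree of `K`. -/
theorem norm_kloostermanSum_comp_trace_le {F : Type*} [Field F] [Fintype F] [DecidableEq F]
    [Algebra F K] {ψ : AddChar F ℂ} (hψ : ψ ≠ 1) (b : F) {N : ℕ} (hN : 1 ≤ N)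
    (hK : Module.finrank F K = 2 * N) :
    ‖kloostermanSum (ψ.compAddMonoidHom (Algebra.trace F K).toAddMonoidHom) (algebraMap F K b)‖ ≤
      4 * (Fintype.card F : ℝ) ^ (N + 1) := by
  set q := Fintype.card F with hq
  have hq1 : 1 ≤ q := Fintype.card_pos
  set S : F → ℕ := fun c => (Finset.univ.filter fun x : K =>
        x ≠ 0 ∧ Algebra.trace F K (x + algebraMap F K b * x⁻¹) = c).card with hS
  set M : ℕ := q ^ (2 * N - 1) + 3 * q ^ N with hM
  have hSM : ∀ c, S c ≤ M := fun c => card_trace_add_inv_eq_le b c hN hK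
  have hSsum : ∑ c, S c + 1 = q ^ (2 * N) := by
    have h1 : ∑ c, S c = (Finset.univ.filter fun x : K => x ≠ 0).card := by
      rw [Finset.card_eq_sum_card_fiberwise (f := fun x : K =>
        Algebra.trace F K (x + algebraMap F K b * x⁻¹)) (t := Finset.univ) (by simp)]
      simp only [hS, Finset.filter_filter]
    rw [h1, Finset.filter_ne', Finset.card_erase_of_mem (Finset.mem_univ _), Finset.card_univ,
      Nat.sub_add_cancel Fintype.card_pos, Module.card_eq_pow_finrank (K := F) (V := K), hK]
  have hkl : kloostermanSum (ψ.compAddMonoidHom (Algebra.trace F K).toAddMonoidHom)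
      (algebraMap F K b) = ∑ c, (S c : ℂ) * ψ c := by
    rw [kloostermanSum, ← Finset.sum_fiberwise _ (fun x : K =>
        Algebra.trace F K (x + algebraMap F K b * x⁻¹))]
    refine Finset.sum_congr rfl fun c _ => ?_
    rw [hS, ← nsmul_eq_mul, ← Finset.sum_const, Finset.filter_filter]
    refine Finset.sum_congr rfl fun x hx => ?_
    have := (Finset.mem_filter.1 hx).2.2
    simp [← this]
  have hkl' : kloostermanSum (ψ.compAddMonoidHom (Algebra.trace F K).toAddMonoidHom)
      (algebraMap F K b) = ∑ c, -((M - S c : ℕ) : ℂ) * ψ c := by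
    -- Orthogonality allows replacing `S c` by `S c - M`, which is never positive.
    have h0 : ∑ c, (M : ℂ) * ψ c = 0 := by
      rw [← Finset.mul_sum, AddChar.sum_eq_zero_of_ne_one hψ, mul_zero]
    rw [hkl, ← sub_zero (∑ c, (S c : ℂ) * ψ c), ← h0, ← Finset.sum_sub_distrib]
    refine Finset.sum_congr rfl fun c _ => ?_
    rw [Nat.cast_sub (hSM c)]
    ring
  have hle : ∑ c, (M - S c) ≤ 4 * q ^ (N + 1) := by
    have h1 : ∑ c, (M - S c) + ∑ c, S c = q * M := by
      rw [← Finset.sum_add_distrib, Finset.sum_congr rfl fun c _ => Nat.sub_add_cancel (hSM c)]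
      simp [hq]
    have h2 : q * M = q ^ (2 * N) + 3 * q ^ (N + 1) := by
      rw [hM, mul_add, ← pow_succ', Nat.sub_add_cancel (by omega)]
      ring
    have h3 : 1 ≤ q ^ (N + 1) := Nat.one_le_pow _ _ hq1
    omega
  calc _ ≤ ∑ c, ‖-((M - S c : ℕ) : ℂ) * ψ c‖ := by rw [hkl']; exact norm_sum_le _ _
    _ = ∑ c, ((M - S c : ℕ) : ℝ) := by
      refine Finset.sum_congr rfl fun c _ => ?_
      rw [norm_mul, norm_neg, AddChar.norm_apply, mul_one, Complex.norm_natCast]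
    _ ≤ _ := by exact_mod_cast hle

theorem sum_comp_sq (hK : ringChar K ≠ 2) (h : K → ℂ) :
    ∑ v, h (v ^ 2) = ∑ w, (1 + (quadraticChar K w : ℂ)) * h w := by
  rw [← Finset.sum_fiberwise _ (fun v : K => v ^ 2)]
  refine Finset.sum_congr rfl fun w _ => ?_
  rw [Finset.sum_congr rfl (g := fun _ => h w) fun v hv => by rw [(Finset.mem_filter.1 hv).2],
    Finset.sum_const, nsmul_eq_mul]
  congr 1
  have := quadraticChar_card_sqrts hK w
  have h2 : {x : K | x ^ 2 = w}.toFinset = Finset.univ.filter fun v : K => v ^ 2 = w := by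
    ext; simp
  rw [h2] at this
  rw [add_comm]
  exact_mod_cast congrArg (Int.cast : ℤ → ℂ) this

theorem sum_comp_sq_add_sum_comp_nonsquare_mul_sq (hK : ringChar K ≠ 2) {δ : K}
    (hδ : ¬ IsSquare δ) (h : K → ℂ) : ∑ v, h (v ^ 2) + ∑ v, h (δ * v ^ 2) = 2 * ∑ w, h w := by
  have hδ0 : δ ≠ 0 := by rintro rfl; exact hδ (IsSquare.zero)
  have h2 : ∑ v, h (δ * v ^ 2) = ∑ w, (1 - (quadraticChar K w : ℂ)) * h w := by
    rw [sum_comp_sq hK fun w => h (δ * w), ← Equiv.sum_comp (Equiv.mulLeft₀ δ hδ0)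
      fun w => (1 - (quadraticChar K w : ℂ)) * h w]
    refine Finset.sum_congr rfl fun w _ => ?_
    rw [Equiv.mulLeft₀_apply, map_mul, quadraticChar_neg_one_iff_not_isSquare.2 hδ]
    push_cast
    ring
  rw [sum_comp_sq hK, h2, ← Finset.sum_add_distrib, Finset.mul_sum]
  exact Finset.sum_congr rfl fun w _ => by ring

theorem QuadraticAlgebra.algebra_trace_eq {R : Type*} [CommRing R] [Nontrivial R] {a b : R}
    (z : QuadraticAlgebra R a b) : Algebra.trace R _ z = 2 * z.re + b * z.im := by
  rw [Algebra.trace_eq_matrix_trace (QuadraticAlgebra.basis a b), Matrix.trace_fin_two,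
    Algebra.leftMulMatrix_eq_repr_mul, Algebra.leftMulMatrix_eq_repr_mul]
  have h0 : (QuadraticAlgebra.basis a b) 0 = 1 := by
    apply (QuadraticAlgebra.basis a b).repr.injective
    ext i; fin_cases i <;> simp
  have h1 : (QuadraticAlgebra.basis a b) 1 = QuadraticAlgebra.omega := by
    apply (QuadraticAlgebra.basis a b).repr.injective
    ext i; fin_cases i <;> simp
  simp [h0, h1]
  ring

instance (R : Type*) [Fintype R] (a b : R) : Fintype (QuadraticAlgebra R a b) :=
  Fintype.ofEquiv _ (QuadraticAlgebra.equivProd a b).symm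

theorem sum_addChar_mul_one_add_div (hK : ringChar K ≠ 2) {ψ : AddChar K ℂ} (hψ : ψ ≠ 1)
    {a : K} (ha : a ≠ 0) :
    ∑ u : K, ∑ w : K, (if w = 0 then 0 else ψ (2 * u * (1 + a * w⁻¹))) = Fintype.card K := by
  have h2 : (2 : K) ≠ 0 := Ring.two_ne_zero hK
  rw [Finset.sum_comm, Finset.sum_eq_single (-a)]
  · simp [ha]
  · intro w _ hw
    rcases eq_or_ne w 0 with rfl | hw0
    · simp
    simp only [hw0, if_false]
    have := AddChar.sum_mulShift (2 * (1 + a * w⁻¹)) (AddChar.IsPrimitive.of_ne_one hψ)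
    rw [if_neg] at this
    · rw [Nat.cast_zero] at this
      rw [← this]
      exact Finset.sum_congr rfl fun u _ => by congr 1; ring
    · refine mul_ne_zero h2 fun h => hw ?_
      field_simp at h
      linear_combination h
  · simp

/-- The substitution `(x, y) = (u + v, u - v)` writes the square as a sum over `K × K` of a function of
the trace `2 u` and norm `u² - v²` of the split quadratic algebra. -/
theorem kloostermanSum_sq (hK : ringChar K ≠ 2) (ψ : AddChar K ℂ) (a : K) :
    kloostermanSum ψ a ^ 2 = ∑ u : K, ∑ v : K,
      (if u ^ 2 - v ^ 2 = 0 then 0 else ψ (2 * u * (1 + a * (u ^ 2 - v ^ 2)⁻¹))) := by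
  have h2 : (2 : K) ≠ 0 := Ring.two_ne_zero hK
  let e : K × K ≃ K × K :=
    { toFun := fun p => (p.1 + p.2, p.1 - p.2)
      invFun := fun p => ((p.1 + p.2) / 2, (p.1 - p.2) / 2)
      left_inv := fun p => by ext <;> simp <;> field_simp <;> ring
      right_inv := fun p => by ext <;> simp <;> field_simp <;> ring }
  rw [kloostermanSum, sq, Finset.sum_filter, Finset.sum_mul_sum, ← Fintype.sum_prod_type',
    ← Fintype.sum_prod_type', ← e.sum_comp]
  refine Finset.sum_congr rfl fun p _ => ?_
  have hp : p.1 ^ 2 - p.2 ^ 2 = (p.1 + p.2) * (p.1 - p.2) := by ring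
  simp only [e, Equiv.coe_fn_mk, hp, mul_eq_zero]
  by_cases hx : p.1 + p.2 = 0
  · simp [hx]
  by_cases hy : p.1 - p.2 = 0
  · simp [hy]
  simp only [hx, hy, not_false_eq_true, if_true, ne_eq, or_self, if_false]
  rw [← AddChar.map_add_eq_mul]
  congr 1
  field_simp
  ring

/-- The Kloosterman sum over the quadratic extension `L = K(√δ)` is `2 #K` minus the square of the one
over `K`. For fixed `u`, the values `u² - v²` and the norms `u² - δ v²` together take every value
exactly twice. -/
theorem kloostermanSum_quadraticAlgebra (hK : ringChar K ≠ 2) {δ : K}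
    [Fact (∀ r : K, r ^ 2 ≠ δ + 0 * r)] [DecidableEq (QuadraticAlgebra K δ 0)]
    {ψ : AddChar K ℂ} (hψ : ψ ≠ 1) {a : K} (ha : a ≠ 0) :
    kloostermanSum (ψ.compAddMonoidHom
        (Algebra.trace K (QuadraticAlgebra K δ 0)).toAddMonoidHom) (algebraMap K _ a) =
      2 * Fintype.card K - kloostermanSum ψ a ^ 2 := by
  have hδ : ¬ IsSquare δ := by
    rintro ⟨r, hr⟩
    exact (Fact.out : ∀ r : K, r ^ 2 ≠ δ + 0 * r) r (by rw [hr]; ring)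
  set f : K → K → ℂ := fun u w => if w = 0 then 0 else ψ (2 * u * (1 + a * w⁻¹)) with hf
  have hL : kloostermanSum (ψ.compAddMonoidHom
      (Algebra.trace K (QuadraticAlgebra K δ 0)).toAddMonoidHom) (algebraMap K _ a) =
      ∑ u : K, ∑ v : K, f u (u ^ 2 - δ * v ^ 2) := by
    rw [kloostermanSum, Finset.sum_filter, ← Fintype.sum_prod_type',
      ← (QuadraticAlgebra.equivProd δ 0).symm.sum_comp]
    refine Finset.sum_congr rfl fun p _ => ?_
    set z : QuadraticAlgebra K δ 0 := (QuadraticAlgebra.equivProd δ 0).symm p with hz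
    have hre : z.re = p.1 := rfl
    have him : z.im = p.2 := rfl
    have hn : p.1 ^ 2 - δ * p.2 ^ 2 = z.norm := by
      rw [QuadraticAlgebra.norm_def, hre, him]; ring
    rw [hn, hf]
    by_cases h0 : z = 0
    · simp [h0]
    have h0' : z.norm ≠ 0 := fun h => h0 (QuadraticAlgebra.norm_eq_zero_iff_eq_zero.1 h)
    simp only [h0, h0', ne_eq, not_false_eq_true, if_true, if_false,
      AddChar.compAddMonoidHom_apply, LinearMap.toAddMonoidHom_coe,
      QuadraticAlgebra.algebra_trace_eq]
    congr 1
    simp [QuadraticAlgebra.re_inv, QuadraticAlgebra.im_inv, hre]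
    ring
  rw [eq_sub_iff_add_eq, hL, kloostermanSum_sq hK, ← sum_addChar_mul_one_add_div hK hψ ha,
    ← Finset.sum_add_distrib, Finset.mul_sum]
  refine Finset.sum_congr rfl fun u _ => ?_
  have := sum_comp_sq_add_sum_comp_nonsquare_mul_sq hK hδ fun w => f u (u ^ 2 - w)
  rw [add_comm, this]
  congr 1
  exact (Equiv.subLeft (u ^ 2)).sum_comp (f u)

end

universe u

section
variable {F : Type u} [Field F] [Fintype F] [DecidableEq F]

/-- If a Kloosterman sum exceeds `2 √q`, the relative excess at least quadruples in each quadratic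
extension of a tower. -/
theorem exists_extension_le_norm_kloostermanSum (hF : ringChar F ≠ 2) {ψ : AddChar F ℂ}
    (hψ : ψ ≠ 1) {a : F} (ha : a ≠ 0) {ε : ℝ} (hε : 0 ≤ ε)
    (h : (2 + ε) * √(Fintype.card F) ≤ ‖kloostermanSum ψ a‖) (k : ℕ) :
    ∃ (L : Type u) (_ : Field L) (_ : Fintype L) (_ : DecidableEq L) (_ : Algebra F L),
      Module.finrank F L = 2 ^ k ∧
      (2 + 4 ^ k * ε) * √(Fintype.card L) ≤ ‖kloostermanSum
        (ψ.compAddMonoidHom (Algebra.trace F L).toAddMonoidHom) (algebraMap F L a)‖ := by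
  induction k with
  | zero =>
    refine ⟨F, inferInstance, inferInstance, inferInstance, inferInstance, by simp, ?_⟩
    have : ψ.compAddMonoidHom (Algebra.trace F F).toAddMonoidHom = ψ := by
      ext x; simp
    rw [this]
    simpa using h
  | succ k ih =>
    obtain ⟨L, _, _, _, _, hrank, hL⟩ := ih
    have hcL : ringChar L ≠ 2 := by rwa [← Algebra.ringChar_eq F L]
    obtain ⟨δ, hδ⟩ := FiniteField.exists_nonsquare hcL
    have : Fact (∀ r : L, r ^ 2 ≠ δ + 0 * r) := ⟨fun r hr => hδ ⟨r, by rw [← sq, hr]; ring⟩⟩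
    have hdec : DecidableEq (QuadraticAlgebra L δ 0) := Classical.decEq _
    have hψL : ψ.compAddMonoidHom (Algebra.trace F L).toAddMonoidHom ≠ 1 := by
      obtain ⟨x, hx⟩ := AddChar.ne_one_iff.1 hψ
      obtain ⟨y, hy⟩ := Algebra.trace_surjective F L x
      exact AddChar.ne_one_iff.2 ⟨y, by simpa [hy] using hx⟩
    have haL : algebraMap F L a ≠ 0 := by simpa using ha
    refine ⟨QuadraticAlgebra L δ 0, inferInstance, inferInstance, hdec, inferInstance, ?_, ?_⟩
    · rw [← Module.finrank_mul_finrank F L, hrank, QuadraticAlgebra.finrank_eq_two, pow_succ]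
    have key := kloostermanSum_quadraticAlgebra hcL (δ := δ) hψL haL
    have htr : (ψ.compAddMonoidHom (Algebra.trace F L).toAddMonoidHom).compAddMonoidHom
        (Algebra.trace L (QuadraticAlgebra L δ 0)).toAddMonoidHom =
        ψ.compAddMonoidHom (Algebra.trace F (QuadraticAlgebra L δ 0)).toAddMonoidHom := by
      ext x; simp [Algebra.trace_trace]
    rw [htr, ← IsScalarTower.algebraMap_apply] at key
    rw [key]
    have hcard : Fintype.card (QuadraticAlgebra L δ 0) = Fintype.card L ^ 2 := by
      rw [Module.card_eq_pow_finrank (K := L), QuadraticAlgebra.finrank_eq_two]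
    rw [hcard, Nat.cast_pow, Real.sqrt_sq (Nat.cast_nonneg _)]
    set κ := kloostermanSum (ψ.compAddMonoidHom (Algebra.trace F L).toAddMonoidHom)
      (algebraMap F L a)
    have h1 : ‖κ‖ ^ 2 - 2 * Fintype.card L ≤ ‖2 * (Fintype.card L : ℂ) - κ ^ 2‖ := by
      have := norm_sub_norm_le (κ ^ 2) (2 * (Fintype.card L : ℂ))
      rw [norm_sub_rev] at this
      simpa using this
    have h2 : ((2 + 4 ^ k * ε) * √(Fintype.card L)) ^ 2 ≤ ‖κ‖ ^ 2 :=
      pow_le_pow_left₀ (by positivity) hL 2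
    rw [mul_pow, Real.sq_sqrt (Nat.cast_nonneg _)] at h2
    have h3 : (0 : ℝ) ≤ (4 ^ k * ε) ^ 2 * Fintype.card L := by positivity
    have h4 : (4 : ℝ) ^ (k + 1) * ε = 4 * (4 ^ k * ε) := by ring
    rw [h4]
    generalize (4 : ℝ) ^ k * ε = t at *
    linarith

/-- Weil's bound for Kloosterman sums in odd characteristic: an excess over `2 √q` would outgrow the
bound `norm_kloostermanSum_comp_trace_le`, which is uniform in the tower. -/
theorem norm_kloostermanSum_le (hF : ringChar F ≠ 2) {ψ : AddChar F ℂ} (hψ : ψ ≠ 1) {a : F}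
    (ha : a ≠ 0) : ‖kloostermanSum ψ a‖ ≤ 2 * √(Fintype.card F) := by
  by_contra! hcon
  set q := Fintype.card F with hq
  have hqpos : (0 : ℝ) < q := by exact_mod_cast Fintype.card_pos
  have hq0 : (0 : ℝ) < √q := Real.sqrt_pos.2 hqpos
  set ε : ℝ := ‖kloostermanSum ψ a‖ / √q - 2 with hε
  have hε0 : 0 < ε := by
    rw [hε, sub_pos, lt_div_iff₀ hq0]
    exact hcon
  have h : (2 + ε) * √q ≤ ‖kloostermanSum ψ a‖ := by
    rw [hε, add_sub_cancel, div_mul_cancel₀ _ hq0.ne']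
  obtain ⟨k, hk⟩ := pow_unbounded_of_one_lt (4 * q / ε) (by norm_num : (1 : ℝ) < 4)
  rw [div_lt_iff₀ hε0] at hk
  obtain ⟨L, _, _, _, _, hrank, hL⟩ :=
    exists_extension_le_norm_kloostermanSum hF hψ ha hε0.le h (k + 1)
  rw [pow_succ'] at hrank
  have hup := hL.trans (norm_kloostermanSum_comp_trace_le hψ a Nat.one_le_two_pow hrank)
  have hcard : (Fintype.card L : ℝ) = ((q : ℝ) ^ 2 ^ k) ^ 2 := by
    rw [Module.card_eq_pow_finrank (K := F) (V := L), hrank, ← hq]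
    push_cast
    rw [← pow_mul, mul_comm]
  rw [hcard, Real.sqrt_sq (by positivity), pow_succ (q : ℝ), ← mul_assoc, mul_right_comm] at hup
  have hup' := le_of_mul_le_mul_right hup (pow_pos hqpos _)
  have : (4 : ℝ) ^ (k + 1) * ε = 4 * (4 ^ k * ε) := by ring
  nlinarith [Nat.cast_nonneg (α := ℝ) q]
end

/-! ### Quadratic Gauss sums and Salié sums -/

theorem norm_sum_sq_eq_card_of_autocorrelation {V : Type*} [AddCommGroup V] [Fintype V]
    {φ : V → ℂ} (hφ : ∀ x, ‖φ x‖ = 1)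
    (h : ∀ y ≠ 0, ∑ x, φ (x + y) * (starRingEnd ℂ) (φ x) = 0) :
    ‖∑ x, φ x‖ ^ 2 = Fintype.card V := by
  have h1 : (∑ x, φ x) * (starRingEnd ℂ) (∑ x, φ x) = Fintype.card V := by
    rw [map_sum, Finset.mul_sum]
    simp_rw [Finset.sum_mul]
    calc ∑ x, ∑ y, φ y * (starRingEnd ℂ) (φ x)
        = ∑ x, ∑ y, φ (x + y) * (starRingEnd ℂ) (φ x) :=
          Finset.sum_congr rfl fun x _ =>
            (Equiv.sum_comp (Equiv.addLeft x) fun y => φ y * (starRingEnd ℂ) (φ x)).symm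
      _ = ∑ y, ∑ x, φ (x + y) * (starRingEnd ℂ) (φ x) := Finset.sum_comm
      _ = ∑ x, φ (x + 0) * (starRingEnd ℂ) (φ x) :=
          Finset.sum_eq_single 0 (fun y _ hy => h y hy) (by simp)
      _ = Fintype.card V := by
          simp [Complex.mul_conj, Complex.normSq_eq_norm_sq, hφ]
  rw [Complex.mul_conj, Complex.normSq_eq_norm_sq] at h1
  exact_mod_cast h1

theorem AddChar.mul_conj_eq_map_sub {A : Type*} [AddCommGroup A] [Finite A] (χ : AddChar A ℂ)
    (x y : A) : χ x * (starRingEnd ℂ) (χ y) = χ (x - y) := by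
  rw [sub_eq_add_neg, AddChar.map_add_eq_mul, AddChar.map_neg_eq_conj]

section
variable {F : Type*} [Field F] [Fintype F] [DecidableEq F] {χ : AddChar F ℂ}

theorem AddChar.sum_mul_left_eq_ite (hχ : χ ≠ 1) (s : F) :
    ∑ x, χ (s * x) = if s = 0 then (Fintype.card F : ℂ) else 0 := by
  have := AddChar.sum_mulShift s (AddChar.IsPrimitive.of_ne_one hχ)
  simpa [mul_comm] using this

theorem sum_quadraticChar_mul_addChar (hF : ringChar F ≠ 2) (hχ : χ ≠ 1) {s : F} (hs : s ≠ 0) :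
    ∑ t, (quadraticChar F t : ℂ) * χ (s * t) = ∑ x, χ (s * x ^ 2) := by
  rw [sum_comp_sq hF fun w => χ (s * w)]
  simp only [add_mul, one_mul, Finset.sum_add_distrib, AddChar.sum_mul_left_eq_ite hχ, hs, if_false,
    zero_add]

theorem norm_sum_addChar_mul_sq (hF : ringChar F ≠ 2) (hχ : χ ≠ 1) {s : F} (hs : s ≠ 0) :
    ‖∑ x, χ (s * x ^ 2)‖ = √(Fintype.card F) := by
  rw [← norm_sum_sq_eq_card_of_autocorrelation (φ := fun x => χ (s * x ^ 2)),
    Real.sqrt_sq (norm_nonneg _)]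
  · simp
  · intro y hy
    have h0 : 2 * s * y ≠ 0 := mul_ne_zero (mul_ne_zero (Ring.two_ne_zero hF) hs) hy
    have : ∀ x, χ (s * (x + y) ^ 2) * (starRingEnd ℂ) (χ (s * x ^ 2)) =
        χ (s * y ^ 2) * χ (2 * s * y * x) := fun x => by
      rw [AddChar.mul_conj_eq_map_sub, ← AddChar.map_add_eq_mul]
      congr 1; ring
    simp only [this, ← Finset.mul_sum, AddChar.sum_mul_left_eq_ite hχ, h0, if_false, mul_zero]

theorem sum_addChar_mul_sq_add (hF : ringChar F ≠ 2) (hχ : χ ≠ 1) {s : F} (hs : s ≠ 0) :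
    ∑ x, χ (s * x ^ 2 + 2 * x) = (quadraticChar F s : ℂ) * χ (-s⁻¹) * ∑ x, χ (1 * x ^ 2) := by
  have h1 : ∑ x, χ (s * x ^ 2) = (quadraticChar F s : ℂ) * ∑ x, χ (1 * x ^ 2) := by
    rw [← sum_quadraticChar_mul_addChar hF hχ hs, ← sum_quadraticChar_mul_addChar hF hχ one_ne_zero,
      ← Equiv.sum_comp (Equiv.mulLeft₀ s hs) fun t => (quadraticChar F t : ℂ) * χ (1 * t),
      Finset.mul_sum]
    refine Finset.sum_congr rfl fun t _ => ?_
    rw [Equiv.mulLeft₀_apply, map_mul (quadraticChar F), one_mul]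
    have h := congrArg (Int.cast : ℤ → ℂ) (quadraticChar_sq_one hs)
    push_cast at h ⊢
    linear_combination (-(quadraticChar F t : ℂ) * χ (s * t)) * h
  rw [mul_right_comm, ← h1, ← Equiv.sum_comp (Equiv.addRight s⁻¹) fun x => χ (s * x ^ 2),
    Finset.sum_mul]
  refine Finset.sum_congr rfl fun x _ => ?_
  rw [← AddChar.map_add_eq_mul, Equiv.coe_addRight]
  congr 1
  field_simp
  ring

/-- The bound for Salié sums. Completing the square in `sum_addChar_mul_sq_add` turns the Salié sum
times a Gauss sum into `q ∑ χ(2 x)` over the at most two `x` with `x² = a b`. -/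
theorem norm_sum_quadraticChar_mul_addChar_le (hF : ringChar F ≠ 2) (hχ : χ ≠ 1) {a : F}
    (ha : a ≠ 0) (b : F) :
    ‖∑ t, (quadraticChar F t : ℂ) * χ (a * t + b * t⁻¹)‖ ≤ 2 * √(Fintype.card F) := by
  have hq0 : (0 : ℝ) < √(Fintype.card F) := Real.sqrt_pos.2 (by exact_mod_cast Fintype.card_pos)
  rcases eq_or_ne b 0 with rfl | hb
  · simp only [zero_mul, add_zero, sum_quadraticChar_mul_addChar hF hχ ha,
      norm_sum_addChar_mul_sq hF hχ ha]
    linarith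
  set S := ∑ t, (quadraticChar F t : ℂ) * χ (a * t + b * t⁻¹) with hS
  set G := ∑ x, χ (1 * x ^ 2) with hG
  have hη : ‖(quadraticChar F (-b⁻¹) : ℂ)‖ = 1 := by
    have h0 : -b⁻¹ ≠ 0 := by simpa using hb
    rcases quadraticChar_dichotomy h0 with h | h <;> rw [h] <;> simp
  have hcard : (Finset.univ.filter fun x : F => a - b⁻¹ * x ^ 2 = 0).card ≤ 2 := by
    have h1 : (Finset.univ.filter fun x : F => a - b⁻¹ * x ^ 2 = 0) =
        {x : F | x ^ 2 = a * b}.toFinset := by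
      ext x
      simp only [Finset.mem_filter, Finset.mem_univ, true_and, Set.mem_toFinset, Set.mem_ofPred_eq]
      field_simp
      rw [mul_zero, sub_eq_zero, eq_comm]
    have h2 := quadraticChar_card_sqrts hF (a * b)
    have h3 : quadraticChar F (a * b) ≤ 1 := by
      rcases eq_or_ne (a * b) 0 with h | h
      · simp [h]
      rcases quadraticChar_dichotomy h with h | h <;> norm_num [h]
    rw [h1]
    omega
  have key : (quadraticChar F (-b⁻¹) : ℂ) * S * G =
      Fintype.card F * ∑ x with a - b⁻¹ * x ^ 2 = 0, χ (2 * x) := by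
    calc (quadraticChar F (-b⁻¹) : ℂ) * S * G
        = ∑ t, if t = 0 then 0 else χ (a * t) * ∑ x, χ (-b⁻¹ * t * x ^ 2 + 2 * x) := by
          rw [hS, Finset.mul_sum _ _ (quadraticChar F (-b⁻¹) : ℂ), Finset.sum_mul _ _ G]
          refine Finset.sum_congr rfl fun t _ => ?_
          rcases eq_or_ne t 0 with rfl | ht
          · simp
          -- The coefficient `-t / b` of `x²` is chosen so that the square completes to `χ(b / t)`.
          rw [if_neg ht, sum_addChar_mul_sq_add hF hχ (mul_ne_zero (by simpa using hb) ht), ← hG,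
            map_mul (quadraticChar F), AddChar.map_add_eq_mul,
            show -(-b⁻¹ * t)⁻¹ = b * t⁻¹ by field_simp]
          push_cast
          ring
      _ = ∑ t, (χ (a * t) * ∑ x, χ (-b⁻¹ * t * x ^ 2 + 2 * x) -
            if t = 0 then ∑ x, χ (2 * x) else 0) := by
          refine Finset.sum_congr rfl fun t _ => ?_
          split_ifs with h
          · simp [h]
          · simp
      _ = ∑ t, ∑ x, χ ((a - b⁻¹ * x ^ 2) * t) * χ (2 * x) := by
          rw [Finset.sum_sub_distrib, AddChar.sum_mul_left_eq_ite hχ, if_neg (Ring.two_ne_zero hF)]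
          simp only [ite_self, Finset.sum_const_zero, sub_zero]
          refine Finset.sum_congr rfl fun t _ => ?_
          rw [Finset.mul_sum]
          refine Finset.sum_congr rfl fun x _ => ?_
          rw [← AddChar.map_add_eq_mul, ← AddChar.map_add_eq_mul]
          congr 1; ring
      _ = _ := by
          rw [Finset.sum_comm, Finset.mul_sum, Finset.sum_filter]
          refine Finset.sum_congr rfl fun x _ => ?_
          rw [← Finset.sum_mul, AddChar.sum_mul_left_eq_ite hχ]
          split_ifs <;> simp
  have hn := congrArg norm key
  rw [norm_mul, norm_mul, hη, one_mul, hG, norm_sum_addChar_mul_sq hF hχ one_ne_zero, norm_mul,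
    Complex.norm_natCast] at hn
  have hle : ‖∑ x with a - b⁻¹ * x ^ 2 = 0, χ (2 * x)‖ ≤ 2 := by
    refine (norm_sum_le _ _).trans ?_
    simp only [AddChar.norm_apply, Finset.sum_const, nsmul_eq_mul, mul_one]
    exact_mod_cast hcard
  refine le_of_mul_le_mul_right ?_ hq0
  rw [hn, mul_assoc, Real.mul_self_sqrt (Nat.cast_nonneg _), mul_comm]
  exact mul_le_mul_of_nonneg_right hle (Nat.cast_nonneg _)

theorem norm_sum_addChar_add_inv_le (hF : ringChar F ≠ 2) (hχ : χ ≠ 1) {a : F}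
    (ha : a ≠ 0) (b : F) :
    ‖∑ t with t ≠ 0, χ (a * t + b * t⁻¹)‖ ≤ 2 * √(Fintype.card F) := by
  have h1 : (1 : ℝ) ≤ √(Fintype.card F) := Real.one_le_sqrt.2 (by exact_mod_cast Fintype.card_pos)
  rcases eq_or_ne b 0 with rfl | hb
  · have h0 := AddChar.sum_mul_left_eq_ite hχ a
    rw [if_neg ha, ← Finset.add_sum_erase _ _ (Finset.mem_univ 0), ← Finset.filter_ne', mul_zero,
      AddChar.map_zero_eq_one] at h0
    simp only [zero_mul, add_zero]
    rw [(neg_eq_of_add_eq_zero_right h0).symm, norm_neg, norm_one]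
    linarith
  · have h := norm_kloostermanSum_le hF (ψ := χ.mulShift a)
      (AddChar.IsPrimitive.of_ne_one hχ ha) (a := a⁻¹ * b) (by simp [ha, hb])
    rw [kloostermanSum] at h
    refine le_of_eq_of_le (congrArg norm (Finset.sum_congr rfl fun t _ => ?_)) h
    rw [AddChar.mulShift_apply]
    congr 1
    field_simp
end

/-! ### Exponential sums over quadratic surfaces -/

open Matrix in
theorem Matrix.IsSymm.dotProduct_mulVec_add {R : Type*} [CommRing R] {d : ℕ}
    {a : Matrix (Fin d) (Fin d) R} (ha : a.IsSymm)
    (x y : Fin d → R) : (x + y) ⬝ᵥ (a *ᵥ (x + y)) =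
      x ⬝ᵥ (a *ᵥ x) + 2 * (x ⬝ᵥ (a *ᵥ y)) + y ⬝ᵥ (a *ᵥ y) := by
  have h : y ⬝ᵥ (a *ᵥ x) = x ⬝ᵥ (a *ᵥ y) := by
    rw [dotProduct_mulVec, ← mulVec_transpose, ha.eq, dotProduct_comm]
  rw [mulVec_add, dotProduct_add, add_dotProduct, add_dotProduct, h]
  ring

section
variable {F : Type*} [Field F] [Fintype F] {d : ℕ}

/-- The Gauss sum `∑ χ(t Q(x))` of the quadratic form `Q(x) = x ⬝ᵥ a x` with matrix `a`. -/
noncomputable def quadraticGaussSum (χ : AddChar F ℂ) (a : Matrix (Fin d) (Fin d) F) (t : F) : ℂ :=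
  ∑ x : Fin d → F, χ (t * (x ⬝ᵥ (a.mulVec x)))

open Matrix in
theorem quadraticGaussSum_mul_sq (χ : AddChar F ℂ) (a : Matrix (Fin d) (Fin d) F) (t : F) {u : F}
    (hu : u ≠ 0) : quadraticGaussSum χ a (t * u ^ 2) = quadraticGaussSum χ a t := by
  rw [quadraticGaussSum, quadraticGaussSum,
    ← Equiv.sum_comp (MulAction.toPerm (Units.mk0 u hu) : Equiv.Perm (Fin d → F))
      fun x => χ (t * (x ⬝ᵥ (a *ᵥ x)))]
  refine Finset.sum_congr rfl fun x _ => ?_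
  rw [MulAction.toPerm_apply, Units.smul_mk0, mulVec_smul, dotProduct_smul, smul_dotProduct]
  congr 1
  simp only [smul_eq_mul]
  ring

open Matrix in
theorem sum_addChar_mul_quadratic_sub_dotProduct (hF : ringChar F ≠ 2) (χ : AddChar F ℂ)
    {a : Matrix (Fin d) (Fin d) F} (ha : a.IsSymm) (hu : IsUnit a) (m : Fin d → F) {t : F}
    (ht : t ≠ 0) :
    ∑ x : Fin d → F, χ (t * (x ⬝ᵥ (a *ᵥ x)) - x ⬝ᵥ m) =
      χ (-(((a⁻¹ *ᵥ m) ⬝ᵥ m) / 4) * t⁻¹) * quadraticGaussSum χ a t := by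
  have h2 : (2 : F) ≠ 0 := Ring.two_ne_zero hF
  have h4 : (4 : F) ≠ 0 := by rw [show (4 : F) = 2 * 2 by norm_num]; exact mul_ne_zero h2 h2
  set v := (2 * t)⁻¹ • (a⁻¹ *ᵥ m) with hv
  have hav : a *ᵥ v = (2 * t)⁻¹ • m := by
    rw [hv, mulVec_smul, mulVec_mulVec, Matrix.mul_nonsing_inv _ ((isUnit_iff_isUnit_det a).1 hu),
      one_mulVec]
  rw [quadraticGaussSum, ← Equiv.sum_comp (Equiv.addRight v), Finset.mul_sum]
  refine Finset.sum_congr rfl fun x _ => ?_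
  rw [Equiv.coe_addRight, ha.dotProduct_mulVec_add, hav, ← AddChar.map_add_eq_mul, add_dotProduct,
    hv]
  simp only [dotProduct_smul, smul_dotProduct, smul_eq_mul]
  congr 1
  field_simp
  ring

variable [DecidableEq F] {χ : AddChar F ℂ}

theorem sum_addChar_dotProduct_eq_ite (hχ : χ ≠ 1) (m : Fin d → F) :
    ∑ x : Fin d → F, χ (x ⬝ᵥ m) = if m = 0 then (Fintype.card F : ℂ) ^ d else 0 := by
  split_ifs with hm
  · simp [hm]
  · let f : (Fin d → F) →+ F :=
      { toFun := fun x => x ⬝ᵥ m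
        map_zero' := zero_dotProduct m
        map_add' := fun x y => add_dotProduct x y m }
    refine AddChar.sum_eq_zero_of_ne_one (ψ := χ.compAddMonoidHom f) (AddChar.ne_one_iff.2 ?_)
    obtain ⟨i, hi⟩ := Function.ne_iff.1 hm
    obtain ⟨y, hy⟩ := AddChar.ne_one_iff.1 hχ
    refine ⟨Pi.single i (y / m i), ?_⟩
    have : f (Pi.single i (y / m i)) = y := by
      simp only [f, AddMonoidHom.coe_mk, ZeroHom.coe_mk, single_dotProduct]
      exact div_mul_cancel₀ y hi
    rwa [AddChar.compAddMonoidHom_apply, this]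

open Matrix in
theorem norm_quadraticGaussSum (hF : ringChar F ≠ 2) (hχ : χ ≠ 1) {a : Matrix (Fin d) (Fin d) F}
    (ha : a.IsSymm) (hu : IsUnit a) {t : F} (ht : t ≠ 0) :
    ‖quadraticGaussSum χ a t‖ = √(Fintype.card F) ^ d := by
  have h1 : ‖quadraticGaussSum χ a t‖ ^ 2 = Fintype.card (Fin d → F) := by
    refine norm_sum_sq_eq_card_of_autocorrelation (fun x => by simp) fun y hy => ?_
    have h0 : (2 * t) • (a *ᵥ y) ≠ 0 := by
      refine smul_ne_zero (mul_ne_zero (Ring.two_ne_zero hF) ht) fun h => hy ?_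
      exact (Matrix.mulVec_injective_iff_isUnit.2 hu) (by rw [h, mulVec_zero])
    have : ∀ x, χ (t * ((x + y) ⬝ᵥ (a *ᵥ (x + y)))) *
        (starRingEnd ℂ) (χ (t * (x ⬝ᵥ (a *ᵥ x)))) =
        χ (t * (y ⬝ᵥ (a *ᵥ y))) * χ (x ⬝ᵥ ((2 * t) • (a *ᵥ y))) := fun x => by
      rw [AddChar.mul_conj_eq_map_sub, ← AddChar.map_add_eq_mul, ha.dotProduct_mulVec_add,
        dotProduct_smul, smul_eq_mul]
      congr 1; ring
    simp only [this, ← Finset.mul_sum, sum_addChar_dotProduct_eq_ite hχ, h0, if_false, mul_zero]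
  rw [← Real.sqrt_sq (norm_nonneg _), h1, Fintype.card_fun, Fintype.card_fin, Nat.cast_pow,
    ← Real.sqrt_sq (by positivity : (0 : ℝ) ≤ √(Fintype.card F) ^ d), ← pow_mul, mul_comm d,
    pow_mul, Real.sq_sqrt (Nat.cast_nonneg _)]

/-- A function that only depends on the square class of its argument is a combination of `1` and the
quadratic character. This makes a diagonalization of the quadratic form unnecessary. -/
theorem exists_eq_add_mul_quadraticChar (hF : ringChar F ≠ 2) {g : F → ℂ}
    (hg : ∀ t u, u ≠ 0 → g (t * u ^ 2) = g t) {M : ℝ} (hM : ∀ t ≠ 0, ‖g t‖ ≤ M) :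
    ∃ α β : ℂ, ‖α‖ ≤ M ∧ ‖β‖ ≤ M ∧ ∀ t ≠ 0, g t = α + β * (quadraticChar F t : ℂ) := by
  obtain ⟨δ, hδ⟩ := FiniteField.exists_nonsquare hF
  have hδ0 : δ ≠ 0 := by rintro rfl; exact hδ IsSquare.zero
  have h1 := hM 1 one_ne_zero
  have h2 := hM δ hδ0
  refine ⟨(g 1 + g δ) / 2, (g 1 - g δ) / 2, ?_, ?_, fun t ht => ?_⟩
  · rw [norm_div, Complex.norm_ofNat]
    linarith [norm_add_le (g 1) (g δ)]
  · rw [norm_div, Complex.norm_ofNat]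
    linarith [norm_sub_le (g 1) (g δ)]
  · rcases quadraticChar_dichotomy ht with h | h
    · obtain ⟨u, rfl⟩ := (quadraticChar_one_iff_isSquare ht).1 h
      have := hg 1 u (left_ne_zero_of_mul ht)
      rw [h, ← sq, ← one_mul (u ^ 2), this]
      push_cast
      ring
    · have h3 : quadraticChar F (t * δ⁻¹) = 1 := by
        have h4 : quadraticChar F (t * δ⁻¹) * quadraticChar F δ = quadraticChar F t := by
          rw [← map_mul, inv_mul_cancel_right₀ hδ0]
        rw [h, quadraticChar_neg_one_iff_not_isSquare.2 hδ] at h4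
        linarith
      have h5 : t * δ⁻¹ ≠ 0 := mul_ne_zero ht (inv_ne_zero hδ0)
      obtain ⟨u, hu⟩ := (quadraticChar_one_iff_isSquare h5).1 h3
      have hu0 : u ≠ 0 := by rintro rfl; exact h5 (by simpa using hu)
      have h6 : t = δ * u ^ 2 := by rw [sq, ← hu]; field_simp
      rw [h, h6, hg δ u hu0]
      push_cast
      ring

open Matrix in
/-- The indicator of the surface is expanded in additive characters `χ(t (Q(x) - j))`, and the square
is completed for each `t ≠ 0`; the term `t = 0` is supported at `m = 0`. -/
theorem card_mul_sum_addChar_surface (hF : ringChar F ≠ 2) (hχ : χ ≠ 1)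
    {a : Matrix (Fin d) (Fin d) F} (ha : a.IsSymm) (hu : IsUnit a) (j : F) (m : Fin d → F) :
    Fintype.card F * ∑ x : Fin d → F with x ⬝ᵥ (a *ᵥ x) = j, χ (-(x ⬝ᵥ m)) =
      (if m = 0 then (Fintype.card F : ℂ) ^ d else 0) +
        ∑ t : F with t ≠ 0, quadraticGaussSum χ a t *
          χ (-j * t + -(((a⁻¹ *ᵥ m) ⬝ᵥ m) / 4) * t⁻¹) := by
  calc Fintype.card F * ∑ x : Fin d → F with x ⬝ᵥ (a *ᵥ x) = j, χ (-(x ⬝ᵥ m))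
      = ∑ x : Fin d → F, ∑ t, χ (-j * t) * χ (t * (x ⬝ᵥ (a *ᵥ x)) - x ⬝ᵥ m) := by
        rw [Finset.mul_sum, Finset.sum_filter]
        refine Finset.sum_congr rfl fun x _ => ?_
        have : ∀ t, χ (-j * t) * χ (t * (x ⬝ᵥ (a *ᵥ x)) - x ⬝ᵥ m) =
            χ (-(x ⬝ᵥ m)) * χ ((x ⬝ᵥ (a *ᵥ x) - j) * t) := fun t => by
          rw [← AddChar.map_add_eq_mul, ← AddChar.map_add_eq_mul]
          congr 1; ring
        simp only [this, ← Finset.mul_sum, AddChar.sum_mul_left_eq_ite hχ, sub_eq_zero]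
        split_ifs <;> ring
    _ = ∑ t, χ (-j * t) * ∑ x : Fin d → F, χ (t * (x ⬝ᵥ (a *ᵥ x)) - x ⬝ᵥ m) := by
        rw [Finset.sum_comm]
        simp only [Finset.mul_sum]
    _ = _ := by
        rw [← Finset.add_sum_erase _ _ (Finset.mem_univ 0), ← Finset.filter_ne']
        congr 1
        · have := sum_addChar_dotProduct_eq_ite hχ (-m)
          simpa using this
        · refine Finset.sum_congr rfl fun t ht => ?_
          rw [sum_addChar_mul_quadratic_sub_dotProduct hF χ ha hu m (Finset.mem_filter.1 ht).2,
            AddChar.map_add_eq_mul]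
          ring

theorem sum_mul_addChar_eq_of_eq_add_mul_quadraticChar {g : F → ℂ} {α β : ℂ}
    (hg : ∀ t ≠ 0, g t = α + β * (quadraticChar F t : ℂ)) (f : F → ℂ) :
    ∑ t : F with t ≠ 0, g t * f t =
      α * ∑ t : F with t ≠ 0, f t + β * ∑ t, (quadraticChar F t : ℂ) * f t := by
  have h0 : ∑ t, (quadraticChar F t : ℂ) * f t =
      ∑ t : F with t ≠ 0, (quadraticChar F t : ℂ) * f t := by
    refine (Finset.sum_filter_of_ne fun t _ h => ?_).symm
    rintro rfl
    simp at h
  rw [h0, Finset.mul_sum, Finset.mul_sum, ← Finset.sum_add_distrib]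
  refine Finset.sum_congr rfl fun t ht => ?_
  rw [hg t (Finset.mem_filter.1 ht).2]
  ring

open Matrix in
theorem norm_sum_addChar_surface_le (hF : ringChar F ≠ 2) (hχ : χ ≠ 1)
    {a : Matrix (Fin d) (Fin d) F} (ha : a.IsSymm) (hu : IsUnit a) {j : F} (hj : j ≠ 0)
    {m : Fin d → F} (hm : m ≠ 0) :
    Fintype.card F * ‖∑ x : Fin d → F with x ⬝ᵥ (a *ᵥ x) = j, χ (-(x ⬝ᵥ m))‖ ≤
      4 * √(Fintype.card F) ^ (d + 1) := by
  obtain ⟨α, β, hα, hβ, hg⟩ := exists_eq_add_mul_quadraticChar hF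
    (fun t u hu => quadraticGaussSum_mul_sq χ a t hu)
    (fun t ht => (norm_quadraticGaussSum hF hχ ha hu ht).le)
  have key := congrArg norm (card_mul_sum_addChar_surface hF hχ ha hu j m)
  rw [norm_mul, Complex.norm_natCast, if_neg hm, zero_add,
    sum_mul_addChar_eq_of_eq_add_mul_quadraticChar hg] at key
  rw [key]
  refine (norm_add_le _ _).trans ?_
  rw [norm_mul, norm_mul]
  have h1 := mul_le_mul hα (norm_sum_addChar_add_inv_le hF hχ (neg_ne_zero.2 hj)
    (-(((a⁻¹ *ᵥ m) ⬝ᵥ m) / 4))) (norm_nonneg _) (by positivity)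
  have h2 := mul_le_mul hβ (norm_sum_quadraticChar_mul_addChar_le hF hχ (neg_ne_zero.2 hj)
    (-(((a⁻¹ *ᵥ m) ⬝ᵥ m) / 4))) (norm_nonneg _) (by positivity)
  refine (add_le_add h1 h2).trans (le_of_eq ?_)
  ring

open Matrix in
/-- For `m = 0` the Kloosterman sum degenerates to `-1` and the Salié sum to a Gauss sum, which is what
makes the error smaller than the main term even for `d = 2` and `q = 3`. -/
theorem abs_card_mul_card_surface_sub_le (hF : ringChar F ≠ 2) (hχ : χ ≠ 1)
    {a : Matrix (Fin d) (Fin d) F} (ha : a.IsSymm) (hu : IsUnit a) {j : F} (hj : j ≠ 0) :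
    |(Fintype.card F : ℝ) * (Finset.univ.filter fun x : Fin d → F => x ⬝ᵥ (a *ᵥ x) = j).card
      - (Fintype.card F : ℝ) ^ d| ≤ √(Fintype.card F) ^ d * (1 + √(Fintype.card F)) := by
  obtain ⟨α, β, hα, hβ, hg⟩ := exists_eq_add_mul_quadraticChar hF
    (fun t u hu => quadraticGaussSum_mul_sq χ a t hu)
    (fun t ht => (norm_quadraticGaussSum hF hχ ha hu ht).le)
  have key := card_mul_sum_addChar_surface hF hχ ha hu j 0
  rw [if_pos rfl, sum_mul_addChar_eq_of_eq_add_mul_quadraticChar hg, ← sub_eq_iff_eq_add'] at key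
  simp only [dotProduct_zero, neg_zero, AddChar.map_zero_eq_one, zero_div, zero_mul, add_zero,
    Finset.sum_const, nsmul_eq_mul, mul_one, sum_quadraticChar_mul_addChar hF hχ
      (neg_ne_zero.2 hj)] at key
  have h0 := AddChar.sum_mul_left_eq_ite hχ (-j)
  rw [if_neg (neg_ne_zero.2 hj), ← Finset.add_sum_erase _ _ (Finset.mem_univ 0),
    ← Finset.filter_ne', mul_zero, AddChar.map_zero_eq_one] at h0
  rw [(neg_eq_of_add_eq_zero_right h0).symm] at key
  have key' := congrArg norm key
  have hcast : (Fintype.card F : ℂ) *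
      (Finset.univ.filter fun x : Fin d → F => x ⬝ᵥ (a *ᵥ x) = j).card - (Fintype.card F : ℂ) ^ d =
      (((Fintype.card F : ℝ) * (Finset.univ.filter fun x : Fin d → F => x ⬝ᵥ (a *ᵥ x) = j).card -
        (Fintype.card F : ℝ) ^ d : ℝ) : ℂ) := by push_cast; rfl
  rw [hcast, Complex.norm_real, Real.norm_eq_abs] at key'
  rw [key']
  refine (norm_add_le _ _).trans ?_
  rw [norm_mul, norm_mul, norm_neg, norm_one, norm_sum_addChar_mul_sq hF hχ (neg_ne_zero.2 hj),
    mul_add]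
  exact add_le_add (mul_le_mul_of_nonneg_right hα zero_le_one)
    (mul_le_mul_of_nonneg_right hβ (Real.sqrt_nonneg _))

end

theorem card_surface_bounds {w n : ℝ} {d : ℕ} (hw : √3 ≤ w) (hd : 2 ≤ d)
    (h : |w ^ 2 * n - (w ^ 2) ^ d| ≤ w ^ d * (1 + w)) :
    n ≤ 16 * (w ^ 2) ^ (d - 1) ∧ (w ^ 2) ^ (d - 1) ≤ 16 * n := by
  have hw1 : 1.73 ≤ w := le_trans (Real.le_sqrt_of_sq_le (by norm_num)) hw
  have hw2 : 0 < w ^ 2 := by positivity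
  have hwd : w ^ 2 ≤ w ^ d := pow_le_pow_right₀ (by linarith) hd
  have hsq : (w ^ 2) ^ d = w ^ d * w ^ d := by rw [← pow_mul, mul_comm, pow_mul, sq]
  have hs : (w ^ 2) ^ d = w ^ 2 * (w ^ 2) ^ (d - 1) := by
    rw [← pow_succ', Nat.sub_add_cancel (by omega)]
  -- `1 + w ≤ (15 / 16) w²` holds for `w ≥ √3`, that is for every odd prime power `w²`.
  have h1 : 1 + w ≤ 15 / 16 * w ^ d := by nlinarith
  have h2 : w ^ d * (1 + w) ≤ 15 / 16 * (w ^ 2) ^ d := by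
    rw [hsq]
    have := mul_le_mul_of_nonneg_left h1 (by positivity : 0 ≤ w ^ d)
    linarith
  obtain ⟨h3, h4⟩ := abs_le.1 (h.trans h2)
  rw [hs] at h3 h4
  constructor
  · have : 0 ≤ w ^ 2 * (w ^ 2) ^ (d - 1) := by positivity
    exact le_of_mul_le_mul_left (by linarith) hw2
  · exact le_of_mul_le_mul_left (by linarith) hw2

/-! ### The Fourier transform of the surface -/

theorem lemma2p5 (d : ℕ) (hd : 1 ≤ d) :
    ∃ C : ℝ, 0 < C ∧
      ∀ (F : Type*) [Field F] [Fintype F] [DecidableEq F] (_ : Odd (Fintype.card F))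
        (χ : AddChar F ℂ) (_ : χ ≠ 1)
        (Q : MvPolynomial (Fin d) F) (_ : IsNondegenerateQuadratic Q)
        (j : F) (_ : j ≠ 0),
        (∀ m : Fin d → F, m ≠ 0 →
          ‖fourierFq χ (surfaceIndicator (quadraticSurface Q j)) m‖
              = ‖((Fintype.card F : ℂ) ^ d)⁻¹ * ∑ x ∈ quadraticSurface Q j, χ (-(x ⬝ᵥ m))‖ ∧
          ‖fourierFq χ (surfaceIndicator (quadraticSurface Q j)) m‖
              ≤ C * (Fintype.card F : ℝ) ^ (-((d : ℝ) + 1) / 2)) ∧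
        (2 ≤ d →
          ((fourierFq χ (surfaceIndicator (quadraticSurface Q j)) 0).im = 0 ∧
            (fourierFq χ (surfaceIndicator (quadraticSurface Q j)) 0).re
              ≤ C * (Fintype.card F : ℝ)⁻¹ ∧
            (Fintype.card F : ℝ)⁻¹
              ≤ C * (fourierFq χ (surfaceIndicator (quadraticSurface Q j)) 0).re) ∧
          (((quadraticSurface Q j).card : ℝ) ≤ C * (Fintype.card F : ℝ) ^ (d - 1) ∧
            (Fintype.card F : ℝ) ^ (d - 1) ≤ C * ((quadraticSurface Q j).card : ℝ))) := by
  refine ⟨16, by norm_num, ?_⟩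
  intro F _ _ _ hodd χ hχ Q hQ j hj
  obtain ⟨a, ha, hu, hQa⟩ := hQ
  have hF : ringChar F ≠ 2 := fun h => by
    have := FiniteField.even_card_of_char_two h
    have := Nat.odd_iff.1 hodd
    omega
  set q := Fintype.card F with hq
  have hq3 : 3 ≤ q := by
    have h1 : 1 < q := Fintype.one_lt_card
    obtain ⟨k, hk⟩ := hodd
    omega
  have hq0 : (0 : ℝ) < q := by positivity
  have hS : quadraticSurface Q j =
      Finset.univ.filter fun x : Fin d → F => x ⬝ᵥ (a.mulVec x) = j := by
    rw [quadraticSurface, hQa]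
    refine Finset.filter_congr fun x _ => ?_
    have : MvPolynomial.eval x
        (∑ i, ∑ k, MvPolynomial.C (a i k) * MvPolynomial.X i * MvPolynomial.X k) =
        x ⬝ᵥ (a.mulVec x) := by
      simp only [map_sum, map_mul, MvPolynomial.eval_C, MvPolynomial.eval_X, dotProduct,
        Matrix.mulVec, Finset.mul_sum]
      exact Finset.sum_congr rfl fun i _ => Finset.sum_congr rfl fun k _ => by ring
    rw [this]
  have hfour : ∀ m, fourierFq χ (surfaceIndicator (quadraticSurface Q j)) m =
      ((q : ℂ) ^ d)⁻¹ * ∑ x ∈ quadraticSurface Q j, χ (-(x ⬝ᵥ m)) := by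
    intro m
    rw [fourierFq, ← Finset.sum_subset (Finset.subset_univ (quadraticSurface Q j))]
    · congr 1
      refine Finset.sum_congr rfl fun x hx => ?_
      simp [surfaceIndicator, hx]
    · intro x _ hx
      simp [surfaceIndicator, hx]
  set w := √(q : ℝ) with hw
  have hwq : w ^ 2 = q := Real.sq_sqrt hq0.le
  have hw0 : 0 < w := Real.sqrt_pos.2 hq0
  refine ⟨fun m hm => ⟨by rw [hfour], ?_⟩, fun hd2 => ?_⟩
  · have h1 := norm_sum_addChar_surface_le hF hχ ha hu hj hm
    rw [← hS, ← hq, ← hw] at h1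
    have h2 : (q : ℝ) ^ (-((d : ℝ) + 1) / 2) = (w ^ (d + 1))⁻¹ := by
      rw [hw, Real.sqrt_eq_rpow, ← Real.rpow_natCast, ← Real.rpow_mul hq0.le, ← Real.rpow_neg hq0.le]
      congr 1
      push_cast
      ring
    rw [hfour, norm_mul, norm_inv, norm_pow, Complex.norm_natCast, h2, ← div_eq_inv_mul,
      ← div_eq_mul_inv, div_le_div_iff₀ (by positivity) (by positivity)]
    rw [← hwq] at h1 ⊢
    set T := ‖∑ x ∈ quadraticSurface Q j, χ (-(x ⬝ᵥ m))‖
    have h3 : 0 < w ^ 2 := by positivity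
    refine le_of_mul_le_mul_left ?_ h3
    have h4 := mul_le_mul_of_nonneg_right h1 (by positivity : 0 ≤ w ^ (d + 1))
    have h5 : 4 * w ^ (d + 1) * w ^ (d + 1) = 4 * (w ^ 2 * (w ^ 2) ^ d) := by ring
    have h6 : 0 ≤ w ^ 2 * (w ^ 2) ^ d := by positivity
    linarith
  · have h1 := abs_card_mul_card_surface_sub_le hF hχ ha hu hj
    rw [← hS, ← hq, ← hw] at h1
    have hw3 : √3 ≤ w := Real.sqrt_le_sqrt (by exact_mod_cast hq3)
    obtain ⟨h2, h3⟩ := card_surface_bounds hw3 hd2 (by rw [hwq]; exact h1)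
    rw [hwq] at h2 h3
    have h0 : fourierFq χ (surfaceIndicator (quadraticSurface Q j)) 0 =
        (((quadraticSurface Q j).card / (q : ℝ) ^ d : ℝ) : ℂ) := by
      rw [hfour]
      simp [div_eq_inv_mul]
    have hqd : (q : ℝ)⁻¹ = (q : ℝ) ^ (d - 1) / (q : ℝ) ^ d := by
      rw [← Nat.sub_add_cancel hd, pow_succ, Nat.add_sub_cancel]
      field_simp
    rw [h0, Complex.ofReal_im, Complex.ofReal_re, hqd, ← mul_div_assoc, ← mul_div_assoc]
    exact ⟨⟨rfl, div_le_div_of_nonneg_right h2 (by positivity),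
      div_le_div_of_nonneg_right h3 (by positivity)⟩, h2, h3⟩
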